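/- Let $\mathbb D=\{z\in\mathbb C:|z|<1\}$, let $\mathcal A$ be the class of analytic functions $f$ on $\mathbb D$ with $f(0)=0$, $f'(0)=1$, and let $\mathcal S\subset\mathcal A$ be the subclass of univalent functions. For analytic $g,\varphi$ on $\mathbb D$ write $g\prec\varphi$ if $g=\varphi\circ w$ for some analytic $w:\mathbb D\to\mathbb D$ with $w(0)=0$. Let $\mathcal S^*(\varphi)$ be the class of $f\in\mathcal S$ with $zf'(z)/f(z)\prec\varphi(z)$ (the quotient being assigned the value $1$ at $z=0$). Put $\mathcal S^*_{car}=\mathcal S^*(1+z+z^2/2)$; $\mathcal S^*[A,B]=\mathcal S^*\big((1+Az)/(1+Bz)\big)$ for $-1\le B<A\le 1$; $\mathcal S^*(\alpha)=\mathcal S^*[1-2\alpha,-1]$, $\mathcal S^*_e(\alpha)=\mathcal S^*(\alpha+(1-\alpha)e^z)$ and $\mathcal S^*_L(\alpha)=\mathcal S^*(\alpha+(1-\alpha)\sqrt{1+z})$ for $0\le\alpha<1$; $\mathcal{SS}^*(\beta)=\mathcal S^*\big(((1+z)/(1-z))^\beta\big)$ for $0<\beta\le1$; $\mathcal S^*(\sqrt{1+cz})$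 for $0<c\le 1$ (principal branches throughout); and, for $k\ge0$, let $k\text{-}\mathcal S^*$ be the class of $f\in\mathcal A$ with $\operatorname{Re}\big(zf'(z)/f(z)\big)>k\,\big|zf'(z)/f(z)-1\big|$ for all $z\in\mathbb D$. Then: (i) $\mathcal S^*_{car}\subset\mathcal S^*(\alpha)$ for $0\le\alpha\le 1/4$; (ii) $\mathcal S^*_{car}\subset\mathcal{SS}^*(\beta)$ for $\beta_0\le\beta\le1$, where $\beta_0=\frac{2}{\pi}\arctan\big(3\sqrt{3/5}\big)$; (iii) $k\text{-}\mathcal S^*\subset\mathcal S^*_{car}$ for $k\ge 5/3$; (iv) $\mathcal S^*_e(\alpha)\subset\mathcal S^*_{car}$ for $\alpha_0\le\alpha<1$, where $\alpha_0=\frac{e-2}{2(e-1)}$; (v) $\mathcal S^*_L(\alpha)\subset\mathcal S^*_{car}$ for $1/2\le\alpha<1$; (vi) $\mathcal S^*(\sqrt{1+cz})\subset\mathcal S^*_{car}$ for $0<c\le 3/4$; (vii) for $-1<B<A\le 1$, $\mathcal S^*[A,B]\subset\mathcal S^*_{car}$ if one of the following holds: (a) $1-B^2<2(1-AB)\le 3(1-B^2)$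 and $2A\le 1+B$; (b) $3(1-B^2)\le 2(1-AB)<5(1-B^2)$ and $2A\le 3+5B$; (viii) $\mathcal S^*_{car}\subset\mathcal S^*[1,-(M-1)/M]$ for $M\ge (3+\sqrt5)/4$. The constants in (i)–(vi) and (viii) are best possible: the stated inclusion fails in (i) for $1/4<\alpha<1$, in (ii) for $0<\beta<\beta_0$, in (iii) for $0\le k<5/3$, in (iv) for $0\le\alpha<\alpha_0$, in (v) for $0\le\alpha<1/2$, in (vi) for $3/4<c\le1$, and in (viii) for $1/2<M<(3+\sqrt5)/4$. -/

import Mathlib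

namespace CardioidStarlike

/-- The open unit disk of the complex plane. -/
abbrev disk : Set ℂ := Metric.ball (0 : ℂ) 1

/-- The class `𝒜` of analytic functions on the unit disk with `f(0) = 0` and `f'(0) = 1`.
Functions are total on `ℂ`; only their values on the disk matter. -/
def classA : Set (ℂ → ℂ) :=
  {f | AnalyticOnNhd ℂ f disk ∧ f 0 = 0 ∧ deriv f 0 = 1}

/-- The class `𝒮` of univalent functions in `𝒜`. -/
def classS : Set (ℂ → ℂ) :=
  {f | f ∈ classA ∧ Set.InjOn f disk}

/-- The function `z f'(z) / f(z)`, with its removable singularity at the origin filled in by the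
limit `1` (for `f ∈ 𝒜`). -/
noncomputable def starQuotient (f : ℂ → ℂ) (z : ℂ) : ℂ :=
  if z = 0 then 1 else z * deriv f z / f z

/-- Subordination `g ≺ φ` on the unit disk: `g = φ ∘ w` for a Schwarz function `w`. -/
def Subordinate (g φ : ℂ → ℂ) : Prop :=
  ∃ w : ℂ → ℂ, AnalyticOnNhd ℂ w disk ∧ w 0 = 0 ∧ Set.MapsTo w disk disk ∧
    ∀ z ∈ disk, g z = φ (w z)

/-- The Ma–Minda class `𝒮*(φ)`: univalent normalized `f` with `z f'/f ≺ φ`. -/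
def starlikeClass (φ : ℂ → ℂ) : Set (ℂ → ℂ) :=
  {f | f ∈ classS ∧ Subordinate (starQuotient f) φ}

/-- The class `𝒮*_car`, given by `φ(z) = 1 + z + z²/2`. -/
noncomputable def starCar : Set (ℂ → ℂ) :=
  starlikeClass fun z => 1 + z + z ^ 2 / 2

/-- The Janowski class `𝒮*[A, B]`. -/
noncomputable def janowski (A B : ℝ) : Set (ℂ → ℂ) :=
  starlikeClass fun z => (1 + (A : ℂ) * z) / (1 + (B : ℂ) * z)

/-- The class `𝒮*(α) = 𝒮*[1 - 2α, -1]` of starlike functions of order `α`. -/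
noncomputable def starlikeOfOrder (α : ℝ) : Set (ℂ → ℂ) :=
  janowski (1 - 2 * α) (-1)

/-- The class `𝒮𝒮*(β)` of strongly starlike functions of order `β` (principal power). -/
noncomputable def stronglyStarlike (β : ℝ) : Set (ℂ → ℂ) :=
  starlikeClass fun z => ((1 + z) / (1 - z)) ^ (β : ℂ)

/-- The class `k-𝒮*` of `k`-starlike functions: `Re (z f'/f) > k |z f'/f - 1|` on the disk.
For `k ≥ 0` the condition excludes zeros of `f` in the punctured disk, since division by zero
gives the value `0`, for which the strict inequality fails. -/
def kStarlike (k : ℝ) : Set (ℂ → ℂ) :=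
  {f | f ∈ classA ∧ ∀ z ∈ disk, k * ‖starQuotient f z - 1‖ < (starQuotient f z).re}

/-- The class `𝒮*_e(α)`, given by `φ(z) = α + (1 - α) eᶻ`. -/
noncomputable def starExp (α : ℝ) : Set (ℂ → ℂ) :=
  starlikeClass fun z => (α : ℂ) + (1 - (α : ℂ)) * Complex.exp z

/-- The class `𝒮*_L(α)`, given by `φ(z) = α + (1 - α) √(1 + z)` (principal root). -/
noncomputable def starLemniscate (α : ℝ) : Set (ℂ → ℂ) :=
  starlikeClass fun z => (α : ℂ) + (1 - (α : ℂ)) * (1 + z) ^ (1 / 2 : ℂ)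

/-- The class `𝒮*(√(1 + cz))` (principal root). -/
noncomputable def starCassini (c : ℝ) : Set (ℂ → ℂ) :=
  starlikeClass fun z => (1 + (c : ℂ) * z) ^ (1 / 2 : ℂ)

end CardioidStarlike

/-!
For univalent `φ`, subordination `g ≺ φ` only says that `g` is analytic, `g 0 = φ 0` and `g` takes
its values in `φ(𝔻)`. Every analytic `φ` with `φ 0 = 1` and `Re φ > 0` is `z f' / f` for some
normalized `f`, and such an `f` is automatically univalent. An inclusion between the classes is
therefore an inclusion between planar regions.

Since `2 (1 + z + z² / 2) - 1 = (1 + z)²`, the image of `𝔻` under `1 + z + z² / 2` is bounded by a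
cardioid. In polar coordinates `2 u - 1 = R exp (iθ)` about its cusp `1 / 2` the sharp bounds over
the cardioid become polynomial inequalities in `R`, with a double root at the point of tangency.
-/

namespace CardioidStarlike

open Complex Metric Set

/-! ### Univalence from a positive real part -/

theorem injOn_of_hasDerivAt_re_pos {U : Set ℂ} (hU : Convex ℝ U) {G G' : ℂ → ℂ}
    (hG : ∀ z ∈ U, HasDerivAt G (G' z) z) (hpos : ∀ z ∈ U, 0 < (G' z).re) : InjOn G U := by
  intro a ha b hb hab
  by_contra hne
  have hd : b - a ≠ 0 := sub_ne_zero.mpr (Ne.symm hne)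
  have hmem : ∀ t ∈ Icc (0 : ℝ) 1, a + (t : ℂ) * (b - a) ∈ U := fun t ht => by
    simpa using hU.add_smul_sub_mem ha hb ht
  have hder : ∀ t ∈ Icc (0 : ℝ) 1, HasDerivAt
      (fun t : ℝ => (G (a + (t : ℂ) * (b - a)) / (b - a)).re)
      (G' (a + (t : ℂ) * (b - a))).re t := by
    intro t ht
    have hline : HasDerivAt (fun s : ℂ => a + s * (b - a)) (b - a) (t : ℂ) := by
      simpa using ((hasDerivAt_id (t : ℂ)).mul_const (b - a)).const_add a
    have hcomp := ((hG _ (hmem t ht)).comp (t : ℂ) hline).div_const (b - a)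
    rw [mul_div_cancel_right₀ _ hd] at hcomp
    exact hcomp.real_of_complex
  have hmono : StrictMonoOn (fun t : ℝ => (G (a + (t : ℂ) * (b - a)) / (b - a)).re)
      (Icc 0 1) := by
    refine strictMonoOn_of_deriv_pos (convex_Icc 0 1)
      (fun t ht => (hder t ht).continuousAt.continuousWithinAt) fun t ht => ?_
    rw [(hder t (interior_subset ht)).deriv]
    exact hpos _ (hmem t (interior_subset ht))
  have hlt := hmono (left_mem_Icc.mpr zero_le_one) (right_mem_Icc.mpr zero_le_one) zero_lt_one
  simp [hab] at hlt

theorem exists_differentiableOn_exp_eq {q : ℂ → ℂ} {c : ℂ} {r : ℝ}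
    (hq : DifferentiableOn ℂ q (ball c r)) (hq0 : ∀ z ∈ ball c r, q z ≠ 0) :
    ∃ h : ℂ → ℂ, DifferentiableOn ℂ h (ball c r) ∧ ∀ z ∈ ball c r, q z = exp (h z) := by
  rcases (ball c r).eq_empty_or_nonempty with hempty | hne
  · exact ⟨0, by simp [hempty]⟩
  have hc : c ∈ ball c r := mem_ball_self (nonempty_ball.mp hne)
  obtain ⟨h, hhc, hh⟩ :=
    ((hq.deriv isOpen_ball).div hq hq0).isExactOn_ball.with_val_at c (log (q c))
  have hder : ∀ z ∈ ball c r, HasDerivAt (fun z => q z * exp (-h z)) 0 z := fun z hz => by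
    refine ((hq.differentiableAt (isOpen_ball.mem_nhds hz)).hasDerivAt.mul
      (hh z hz).neg.cexp).congr_deriv ?_
    simp only [Pi.div_apply, Pi.neg_apply]
    field_simp [hq0 z hz]
    ring
  refine ⟨h, fun z hz => (hh z hz).differentiableAt.differentiableWithinAt, fun z hz => ?_⟩
  have hconst : q z * exp (-h z) = q c * exp (-h c) :=
    isOpen_ball.is_const_of_deriv_eq_zero (convex_ball c r).isPreconnected
      (fun z hz => (hder z hz).differentiableAt.differentiableWithinAt)
      (fun z hz => (hder z hz).deriv) hz hc
  rw [hhc, exp_neg (log _), exp_log (hq0 c hc), mul_inv_cancel₀ (hq0 c hc)] at hconst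
  rw [exp_neg] at hconst
  exact eq_of_mul_inv_eq_one hconst

theorem mul_dslope_zero (f : ℂ → ℂ) (z : ℂ) : z * dslope f 0 z = f z - f 0 := by
  simpa using sub_smul_dslope f 0 z

theorem differentiableOn_dslope_zero {f : ℂ → ℂ} (hf : DifferentiableOn ℂ f disk) :
    DifferentiableOn ℂ (dslope f 0) disk :=
  (differentiableOn_dslope (ball_mem_nhds 0 one_pos)).mpr hf

theorem starQuotient_of_eqOn_mul_exp {f h : ℂ → ℂ} (hh : DifferentiableOn ℂ h disk)
    (hf : EqOn f (fun z => z * exp (h z)) disk) {z : ℂ} (hz : z ∈ disk) :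
    starQuotient f z = 1 + z * deriv h z := by
  rcases eq_or_ne z 0 with rfl | hz0
  · simp [starQuotient]
  have hder : deriv f z = 1 * exp (h z) + z * (exp (h z) * deriv h z) := by
    rw [(hf.eventuallyEq_of_mem (isOpen_ball.mem_nhds hz)).deriv_eq]
    exact ((hasDerivAt_id z).mul
      (hh.differentiableAt (isOpen_ball.mem_nhds hz)).hasDerivAt.cexp).deriv
  rw [starQuotient, if_neg hz0, hder, hf hz]
  field_simp [exp_ne_zero (h z)]

theorem injOn_add_comp_exp {h : ℂ → ℂ} (hh : DifferentiableOn ℂ h disk)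
    (hpos : ∀ z ∈ disk, 0 < (1 + z * deriv h z).re) :
    InjOn (fun s => s + h (exp s)) {s : ℂ | s.re < 0} := by
  have hexp : ∀ s : ℂ, s.re < 0 → exp s ∈ disk := fun s hs => by simpa [norm_exp] using hs
  refine injOn_of_hasDerivAt_re_pos (G' := fun s => 1 + exp s * deriv h (exp s))
    (convex_halfSpace_re_lt 0) (fun s hs => ?_) fun s hs => hpos _ (hexp s hs)
  have hcomp := (hh.differentiableAt
    (isOpen_ball.mem_nhds (hexp s hs))).hasDerivAt.comp s (hasDerivAt_exp s)
  rw [mul_comm]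
  exact (hasDerivAt_id s).add hcomp

/-- In the coordinate `s = log z` the map `z ↦ z exp (h z)` becomes `s ↦ s + h (exp s)`, whose
derivative `1 + z h'(z)` has positive real part. -/
theorem injOn_mul_exp {h : ℂ → ℂ} (hh : DifferentiableOn ℂ h disk)
    (hpos : ∀ z ∈ disk, 0 < (1 + z * deriv h z).re) :
    InjOn (fun z => z * exp (h z)) disk := by
  have hlog : ∀ z ∈ disk, z ≠ 0 → (log z).re < 0 := fun z hz hz0 => by
    rw [log_re]
    exact Real.log_neg (norm_pos_iff.mpr hz0) (by simpa using hz)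
  intro a ha b hb hab
  simp only at hab
  rcases eq_or_ne a 0 with rfl | ha0
  · simpa [exp_ne_zero, eq_comm] using hab
  rcases eq_or_ne b 0 with rfl | hb0
  · simpa [exp_ne_zero] using hab
  obtain ⟨n, hn⟩ : ∃ n : ℤ, log a + h a = log b + h b + n * (2 * Real.pi * I) := by
    rw [← exp_eq_exp_iff_exists_int, exp_add, exp_add, exp_log ha0, exp_log hb0, hab]
  have hexp_b : exp (log b + n * (2 * Real.pi * I)) = b := by
    rw [exp_add, exp_log hb0, exp_int_mul_two_pi_mul_I, mul_one]
  have hlog_eq : log a = log b + n * (2 * Real.pi * I) := by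
    refine injOn_add_comp_exp hh hpos (hlog a ha ha0) (by simpa using hlog b hb hb0) ?_
    simp only [hexp_b, exp_log ha0]
    rw [hn]
    ring
  rw [← exp_log ha0, hlog_eq, hexp_b]

theorem exists_eqOn_mul_exp {f : ℂ → ℂ} (hf : f ∈ classA) (h0 : ∀ z ∈ disk, z ≠ 0 → f z ≠ 0) :
    ∃ h : ℂ → ℂ, DifferentiableOn ℂ h disk ∧ EqOn f (fun z => z * exp (h z)) disk := by
  obtain ⟨hfa, hf0, hf1⟩ := hf
  have hfq : ∀ z, f z = z * dslope f 0 z := fun z => by rw [mul_dslope_zero, hf0, sub_zero]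
  have hq0 : ∀ z ∈ disk, dslope f 0 z ≠ 0 := by
    intro z hz hqz
    rcases eq_or_ne z 0 with rfl | hz0
    · simp [hf1] at hqz
    · exact h0 z hz hz0 (by rw [hfq, hqz, mul_zero])
  obtain ⟨h, hh, hqh⟩ := exists_differentiableOn_exp_eq
    (differentiableOn_dslope_zero hfa.differentiableOn) hq0
  exact ⟨h, hh, fun z hz => by simp only [hfq z, hqh z hz]⟩

theorem mem_classS_and_analyticOnNhd_starQuotient {f : ℂ → ℂ} (hf : f ∈ classA)
    (hpos : ∀ z ∈ disk, 0 < (starQuotient f z).re) :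
    f ∈ classS ∧ AnalyticOnNhd ℂ (starQuotient f) disk := by
  have hf0 : ∀ z ∈ disk, z ≠ 0 → f z ≠ 0 := fun z hz hz0 hfz => by
    have hz_pos := hpos z hz
    simp [starQuotient, hz0, hfz] at hz_pos
  obtain ⟨h, hh, hfh⟩ := exists_eqOn_mul_exp hf hf0
  have hquot : EqOn (starQuotient f) (fun z => 1 + z * deriv h z) disk := fun z hz =>
    starQuotient_of_eqOn_mul_exp hh hfh hz
  refine ⟨⟨hf, (injOn_mul_exp hh fun z hz => ?_).congr hfh.symm⟩, ?_⟩
  · simpa only [hquot hz] using hpos z hz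
  · rw [analyticOnNhd_iff_differentiableOn isOpen_ball]
    exact ((differentiableOn_const 1).add
      (differentiableOn_id.mul (hh.deriv isOpen_ball))).congr hquot

theorem exists_mem_classA_eqOn_starQuotient {p : ℂ → ℂ} (hp : DifferentiableOn ℂ p disk)
    (hp0 : p 0 = 1) : ∃ f ∈ classA, EqOn (starQuotient f) p disk := by
  obtain ⟨h, hh0, hh⟩ := (differentiableOn_dslope_zero hp).isExactOn_ball.with_val_at 0 0
  have hhd : DifferentiableOn ℂ h disk := fun z hz =>
    (hh z hz).differentiableAt.differentiableWithinAt
  refine ⟨fun z => z * exp (h z), ⟨?_, by simp, ?_⟩, fun z hz => ?_⟩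
  · rw [analyticOnNhd_iff_differentiableOn isOpen_ball]
    exact differentiableOn_id.mul hhd.cexp
  · exact ((hasDerivAt_id (0 : ℂ)).mul (hh 0 (mem_ball_self one_pos)).cexp).deriv.trans
      (by simp [hh0])
  · rw [starQuotient_of_eqOn_mul_exp hhd (eqOn_refl _ _) hz, (hh z hz).deriv, mul_dslope_zero, hp0]
    ring

theorem exists_mem_classS_eqOn_starQuotient {p : ℂ → ℂ} (hp : DifferentiableOn ℂ p disk)
    (hp0 : p 0 = 1) (hpos : ∀ z ∈ disk, 0 < (p z).re) :
    ∃ f ∈ classS, EqOn (starQuotient f) p disk := by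
  obtain ⟨f, hf, hfp⟩ := exists_mem_classA_eqOn_starQuotient hp hp0
  exact ⟨f, (mem_classS_and_analyticOnNhd_starQuotient hf
    fun z hz => by simpa only [hfp hz] using hpos z hz).1, hfp⟩

/-! ### Subordination -/

theorem Subordinate.trans {g φ χ : ℂ → ℂ} (hgφ : Subordinate g φ) (hφχ : Subordinate φ χ) :
    Subordinate g χ := by
  obtain ⟨v, hv, hv0, hvd, hgv⟩ := hgφ
  obtain ⟨w, hw, hw0, hwd, hφw⟩ := hφχ
  exact ⟨w ∘ v, hw.comp hv hvd, by simp [hv0, hw0], hwd.comp hvd,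
    fun z hz => by rw [hgv z hz, hφw _ (hvd hz), Function.comp_apply]⟩

theorem Subordinate.congr_left {g₁ g₂ φ : ℂ → ℂ} (h : Subordinate g₁ φ) (hg : EqOn g₁ g₂ disk) :
    Subordinate g₂ φ := by
  obtain ⟨w, hw, hw0, hwd, hgw⟩ := h
  exact ⟨w, hw, hw0, hwd, fun z hz => by rw [← hg hz, hgw z hz]⟩

theorem starlikeClass_subset_iff {φ χ : ℂ → ℂ} (hφ : AnalyticOnNhd ℂ φ disk) (hφ0 : φ 0 = 1)
    (hpos : ∀ z ∈ disk, 0 < (φ z).re) :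
    starlikeClass φ ⊆ starlikeClass χ ↔ Subordinate φ χ := by
  refine ⟨fun hsub => ?_, fun hφχ f hf => ⟨hf.1, hf.2.trans hφχ⟩⟩
  obtain ⟨f, hf, hfφ⟩ := exists_mem_classS_eqOn_starQuotient hφ.differentiableOn hφ0 hpos
  have hfφ_sub : Subordinate (starQuotient f) φ :=
    ⟨id, analyticOnNhd_id, rfl, mapsTo_id _, hfφ⟩
  exact (hsub ⟨hf, hfφ_sub⟩).2.congr_left hfφ

/-- `φ` maps `U` biholomorphically onto `V`; only its values on `U` matter, so that `φ` need not be
injective or even continuous elsewhere. -/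
structure IsBiholomorphism (φ : ℂ → ℂ) (U V : Set ℂ) : Prop where
  analyticOnNhd : AnalyticOnNhd ℂ φ U
  mapsTo : MapsTo φ U V
  exists_inverse : ∃ ψ : ℂ → ℂ, AnalyticOnNhd ℂ ψ V ∧ MapsTo ψ V U ∧ InvOn ψ φ U V

namespace IsBiholomorphism

variable {φ χ g : ℂ → ℂ} {U V W : Set ℂ}

theorem comp (hχ : IsBiholomorphism χ V W) (hφ : IsBiholomorphism φ U V) :
    IsBiholomorphism (χ ∘ φ) U W := by
  obtain ⟨ψ, hψ, hψ_maps, hψ_inv⟩ := hφ.exists_inverse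
  obtain ⟨ω, hω, hω_maps, hω_inv⟩ := hχ.exists_inverse
  exact ⟨hχ.analyticOnNhd.comp hφ.analyticOnNhd hφ.mapsTo, hχ.mapsTo.comp hφ.mapsTo, ψ ∘ ω,
    hψ.comp hω hω_maps, hψ_maps.comp hω_maps, hψ_inv.comp hω_inv hφ.mapsTo hω_maps⟩

theorem surjOn (hφ : IsBiholomorphism φ U V) : SurjOn φ U V := by
  obtain ⟨ψ, -, hψ_maps, hψ_inv⟩ := hφ.exists_inverse
  exact hψ_inv.2.surjOn hψ_maps

theorem subordinate_iff (hφ : IsBiholomorphism φ disk W) :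
    Subordinate g φ ↔ AnalyticOnNhd ℂ g disk ∧ MapsTo g disk W ∧ g 0 = φ 0 := by
  have h0 : (0 : ℂ) ∈ disk := mem_ball_self one_pos
  constructor
  · rintro ⟨w, hw, hw0, hwd, hgw⟩
    have hgw' : EqOn (φ ∘ w) g disk := fun z hz => (hgw z hz).symm
    exact ⟨(hφ.analyticOnNhd.comp hw hwd).congr isOpen_ball hgw',
      (hφ.mapsTo.comp hwd).congr hgw', by rw [hgw 0 h0, hw0]⟩
  · rintro ⟨hg, hgW, hg0⟩
    obtain ⟨ψ, hψ, hψ_maps, hψ_inv⟩ := hφ.exists_inverse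
    exact ⟨ψ ∘ g, hψ.comp hg hgW, by rw [Function.comp_apply, hg0, hψ_inv.1 h0],
      hψ_maps.comp hgW, fun z hz => (hψ_inv.2 (hgW hz)).symm⟩

end IsBiholomorphism

/-! ### The cardioid as a conformal image -/

theorem mem_ball_ofReal_iff {u : ℂ} {c r : ℝ} (hr : 0 ≤ r) :
    u ∈ ball (c : ℂ) r ↔ ‖u‖ ^ 2 < 2 * c * u.re + (r ^ 2 - c ^ 2) := by
  have hsub : ‖u - c‖ ^ 2 = ‖u‖ ^ 2 - 2 * c * u.re + c ^ 2 := by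
    rw [Complex.sq_norm, Complex.sq_norm, normSq_sub, normSq_ofReal, conj_ofReal, re_mul_ofReal]
    ring
  rw [mem_ball_iff_norm, ← sq_lt_sq₀ (norm_nonneg _) hr, hsub]
  constructor <;> intro h <;> linarith

theorem re_pos_of_mem_ball_one {u : ℂ} (hu : u ∈ ball (1 : ℂ) 1) : 0 < u.re := by
  rw [← ofReal_one, mem_ball_ofReal_iff zero_le_one] at hu
  nlinarith [sq_nonneg ‖u‖]

/-- The open sector of half-opening angle `γ` about the positive real axis. -/
def sector (γ : ℝ) : Set ℂ :=
  {u | u ≠ 0 ∧ |arg u| < γ}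

theorem mem_slitPlane_of_mem_sector {u : ℂ} {γ : ℝ} (hγ : γ ≤ Real.pi) (hu : u ∈ sector γ) :
    u ∈ slitPlane :=
  mem_slitPlane_iff_arg.mpr ⟨fun h => by
    have := hu.2.trans_le hγ
    rw [h, abs_of_pos Real.pi_pos] at this
    exact this.false, hu.1⟩

theorem mem_sector_pi_iff {u : ℂ} : u ∈ sector Real.pi ↔ u ∈ slitPlane := by
  refine ⟨mem_slitPlane_of_mem_sector le_rfl, fun hu => ⟨slitPlane_ne_zero hu, ?_⟩⟩
  exact abs_lt.mpr ⟨neg_pi_lt_arg u,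
    lt_of_le_of_ne (arg_le_pi u) (mem_slitPlane_iff_arg.mp hu).1⟩

theorem mem_sector_pi_div_two_iff {u : ℂ} : u ∈ sector (Real.pi / 2) ↔ 0 < u.re := by
  rw [sector, mem_ofPred_eq, abs_arg_lt_pi_div_two_iff]
  constructor
  · rintro ⟨hu, h | h⟩
    exacts [h, absurd h hu]
  · exact fun h => ⟨fun hu => by simp [hu] at h, Or.inl h⟩

theorem arg_cpow_ofReal {u : ℂ} {β : ℝ} (hu : u ≠ 0) (h : |β * arg u| < Real.pi) :
    arg (u ^ (β : ℂ)) = β * arg u := by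
  obtain ⟨hlt, hgt⟩ := abs_lt.mp h
  have him : (log u * β).im = β * arg u := by rw [im_mul_ofReal, log_im, mul_comm]
  rw [cpow_def_of_ne_zero hu, ← log_im (exp _),
    log_exp (by rwa [him]) (by rw [him]; exact hgt.le), him]

theorem mapsTo_cpow_sector {β γ : ℝ} (hβ : 0 < β) (hβγ : β * γ ≤ Real.pi) :
    MapsTo (fun u : ℂ => u ^ (β : ℂ)) (sector γ) (sector (β * γ)) := by
  rintro u ⟨hu, hγ⟩
  have habs : |β * arg u| < β * γ := by
    rw [abs_mul, abs_of_pos hβ]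
    exact mul_lt_mul_of_pos_left hγ hβ
  refine ⟨by simp [cpow_eq_zero_iff, hu], ?_⟩
  rwa [arg_cpow_ofReal hu (habs.trans_le hβγ)]

theorem isBiholomorphism_cpow {β γ : ℝ} (hβ : 0 < β) (hγ : γ ≤ Real.pi)
    (hβγ : β * γ ≤ Real.pi) :
    IsBiholomorphism (fun u => u ^ (β : ℂ)) (sector γ) (sector (β * γ)) := by
  have hanalytic : ∀ {β γ : ℝ}, γ ≤ Real.pi →
      AnalyticOnNhd ℂ (fun u : ℂ => u ^ (β : ℂ)) (sector γ) := fun hγ u hu =>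
    analyticAt_id.cpow analyticAt_const (mem_slitPlane_of_mem_sector hγ hu)
  have hcancel : β⁻¹ * (β * γ) = γ := inv_mul_cancel_left₀ hβ.ne' γ
  have hinv : ∀ {β γ : ℝ}, 0 < β → β * γ ≤ Real.pi → ∀ u ∈ sector γ,
      (u ^ (β : ℂ)) ^ ((β⁻¹ : ℝ) : ℂ) = u := by
    intro β γ hβ hβγ u hu
    have habs : |(log u * β).im| < Real.pi := by
      rw [im_mul_ofReal, log_im, abs_mul, abs_of_pos hβ]
      exact (mul_lt_mul_of_pos_right hu.2 hβ).trans_le (by rwa [mul_comm])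
    rw [← cpow_mul _ (abs_lt.mp habs).1 (abs_lt.mp habs).2.le, ← ofReal_mul,
      mul_inv_cancel₀ hβ.ne', ofReal_one, cpow_one]
  refine ⟨hanalytic hγ, mapsTo_cpow_sector hβ hβγ, fun u => u ^ ((β⁻¹ : ℝ) : ℂ), hanalytic hβγ, ?_,
    hinv hβ hβγ, fun u hu => ?_⟩
  · simpa only [hcancel] using mapsTo_cpow_sector (inv_pos.mpr hβ) (hcancel.trans_le hγ)
  · simpa only [inv_inv] using hinv (inv_pos.mpr hβ) (hcancel.trans_le hγ) u hu

theorem re_cpow_one_half_pos {u : ℂ} (hu : u ∈ slitPlane) : 0 < (u ^ (1 / 2 : ℂ)).re := by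
  have hmaps := mapsTo_cpow_sector (β := 1 / 2) (γ := Real.pi) (by norm_num)
    (by linarith [Real.pi_pos])
  rw [one_div_mul_eq_div] at hmaps
  simpa using mem_sector_pi_div_two_iff.mp (hmaps (mem_sector_pi_iff.mpr hu))

theorem sq_cpow_one_half {u : ℂ} (hu : 0 < u.re) : (u ^ 2) ^ (1 / 2 : ℂ) = u := by
  rw [one_div, sq_cpow_two_inv hu]

theorem cpow_one_half_sq (u : ℂ) : (u ^ (1 / 2 : ℂ)) ^ 2 = u := by
  rw [one_div, cpow_ofNat_inv_pow]

/-- The open region bounded by the cardioid `∂φ(𝔻)` for `φ(z) = 1 + z + z² / 2`. Since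
`2 φ(z) - 1 = (1 + z)²`, it is described in polar coordinates `2 u - 1 = R exp (iθ)` about the cusp
`1 / 2` by `R < 2 (1 + cos θ)`; the definition multiplies this inequality by `R`. -/
def cardioid : Set ℂ :=
  {u | ‖2 * u - 1‖ ^ 2 < 2 * (‖2 * u - 1‖ + (2 * u - 1).re)}

theorem two_mul_sub_one_mem_slitPlane {u : ℂ} (hu : u ∈ cardioid) : 2 * u - 1 ∈ slitPlane := by
  rw [mem_slitPlane_iff_not_le_zero]
  intro hle
  obtain ⟨hre, him⟩ := nonpos_iff.mp hle
  have hnorm : ‖2 * u - 1‖ = -(2 * u - 1).re := by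
    rw [← abs_re_eq_norm.mpr him, abs_of_nonpos hre]
  rw [cardioid, mem_ofPred_eq, hnorm, neg_add_cancel, mul_zero] at hu
  exact hu.not_ge (sq_nonneg _)

theorem mem_cardioid_iff_mem_ball_of_sq_eq {u w : ℂ} (hw : 0 < w.re) (h : w ^ 2 = 2 * u - 1) :
    u ∈ cardioid ↔ w ∈ ball (1 : ℂ) 1 := by
  have hre : (w ^ 2).re = 2 * w.re ^ 2 - ‖w‖ ^ 2 := by
    rw [Complex.sq_norm, normSq_apply, sq, mul_re]
    ring
  rw [← ofReal_one, mem_ball_ofReal_iff zero_le_one, cardioid, mem_ofPred_eq, ← h, norm_pow, hre,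
    ← sq_lt_sq₀ (by positivity : 0 ≤ ‖w‖ ^ 2) (by positivity : 0 ≤ 2 * 1 * w.re + (1 ^ 2 - 1 ^ 2))]
  constructor <;> intro h <;> linarith

theorem isBiholomorphism_car :
    IsBiholomorphism (fun z => 1 + z + z ^ 2 / 2) disk cardioid := by
  have hball : ∀ {z : ℂ}, z ∈ disk ↔ 1 + z ∈ ball (1 : ℂ) 1 := by simp
  have hsq : ∀ z : ℂ, (1 + z) ^ 2 = 2 * (1 + z + z ^ 2 / 2) - 1 := fun z => by ring
  refine ⟨fun z _ => by fun_prop, fun z hz => ?_, fun u => (2 * u - 1) ^ (1 / 2 : ℂ) - 1,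
    fun u hu => ?_, fun u hu => ?_, fun z hz => ?_, fun u _ => ?_⟩
  · exact (mem_cardioid_iff_mem_ball_of_sq_eq (re_pos_of_mem_ball_one (hball.mp hz)) (hsq z)).mpr
      (hball.mp hz)
  · have haffine : AnalyticAt ℂ (fun u : ℂ => 2 * u - 1) u := by fun_prop
    exact (haffine.cpow analyticAt_const (two_mul_sub_one_mem_slitPlane hu)).sub analyticAt_const
  · rw [hball, add_sub_cancel]
    exact (mem_cardioid_iff_mem_ball_of_sq_eq
      (re_cpow_one_half_pos (two_mul_sub_one_mem_slitPlane hu)) (cpow_one_half_sq _)).mp hu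
  · simp only
    rw [← hsq, sq_cpow_one_half (re_pos_of_mem_ball_one (hball.mp hz)), add_sub_cancel_left]
  · linear_combination cpow_one_half_sq (2 * u - 1) / 2

/-! ### Bounds on the cardioid -/

theorem four_mul_norm_sq (u : ℂ) : 4 * ‖u‖ ^ 2 = ‖2 * u - 1‖ ^ 2 + 4 * u.re - 1 := by
  simp only [Complex.sq_norm, normSq_apply, sub_re, sub_im, mul_re, mul_im, re_ofNat, im_ofNat,
    one_re, one_im]
  ring

theorem mem_cardioid_iff {u : ℂ} :
    u ∈ cardioid ↔ ‖2 * u - 1‖ ^ 2 - 2 * ‖2 * u - 1‖ + 2 < 4 * u.re := by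
  simp only [cardioid, mem_ofPred_eq, sub_re, mul_re, re_ofNat, im_ofNat, zero_mul, sub_zero,
    one_re]
  constructor <;> intro h <;> linarith

theorem one_fourth_lt_re_of_mem_cardioid {u : ℂ} (hu : u ∈ cardioid) : 1 / 4 < u.re := by
  rw [mem_cardioid_iff] at hu
  linarith [sq_nonneg (‖2 * u - 1‖ - 1)]

theorem norm_sq_lt_of_mem_cardioid {u : ℂ} (hu : u ∈ cardioid) :
    ‖u‖ ^ 2 < (3 + √5) / 2 * u.re := by
  rw [mem_cardioid_iff] at hu
  have hu_norm := four_mul_norm_sq u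
  set R := ‖2 * u - 1‖
  have h5 : √5 ^ 2 = 5 := Real.sq_sqrt (by norm_num)
  have h5_one : 1 < √5 := Real.lt_sqrt_of_sq_lt (by norm_num)
  have hsquare : 0 ≤ (√5 - 1) / 2 * (R - (3 + √5) / 2) ^ 2 := by
    have := sub_pos.mpr h5_one
    positivity
  have hexpand : (√5 - 1) / 2 * (R - (3 + √5) / 2) ^ 2 =
      (1 + √5) / 2 * (R ^ 2 - 2 * R + 2) - (R ^ 2 - 1) := by
    linear_combination (-(R / 2) + 5 / 8 + √5 / 8) * h5
  linarith [mul_lt_mul_of_pos_left hu (by positivity : 0 < (1 + √5) / 2)]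

theorem abs_im_lt_of_mem_cardioid {u : ℂ} (hu : u ∈ cardioid) :
    |u.im| < 3 * √(3 / 5) * u.re := by
  have hre : 0 < u.re := by linarith [one_fourth_lt_re_of_mem_cardioid hu]
  rw [mem_cardioid_iff] at hu
  have hu_norm := four_mul_norm_sq u
  rw [← sq_abs ‖u‖, abs_norm, Complex.sq_norm, normSq_apply] at hu_norm
  set R := ‖2 * u - 1‖
  refine abs_lt_of_sq_lt_sq ?_ (by positivity)
  rw [mul_pow, mul_pow, Real.sq_sqrt (by norm_num)]
  have hmono : 8 * (R ^ 2 - 2 * R + 2) ^ 2 - 5 * (R ^ 2 - 2 * R + 2) <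
      8 * (4 * u.re) ^ 2 - 5 * (4 * u.re) := by
    nlinarith [sq_nonneg (R - 1)]
  have hroot : 8 * (R ^ 2 - 2 * R + 2) ^ 2 - 5 * (R ^ 2 - 2 * R + 2) + 5 - 5 * R ^ 2 =
      (2 * R - 3) ^ 2 * (2 * (R - 1 / 2) ^ 2 + 5 / 2) := by ring
  have hroot_nonneg : 0 ≤ (2 * R - 3) ^ 2 * (2 * (R - 1 / 2) ^ 2 + 5 / 2) := by positivity
  linarith only [hu_norm, hmono, hroot, hroot_nonneg]

theorem arg_eq_arctan {u : ℂ} (hu : 0 < u.re) : arg u = Real.arctan (u.im / u.re) := by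
  obtain ⟨hlt, hgt⟩ := abs_lt.mp (abs_arg_lt_pi_div_two_iff.mpr (Or.inl hu))
  rw [← tan_arg, Real.arctan_tan hlt hgt]

theorem abs_arg_lt_of_mem_cardioid {u : ℂ} (hu : u ∈ cardioid) :
    |arg u| < Real.arctan (3 * √(3 / 5)) := by
  have hre : 0 < u.re := by linarith [one_fourth_lt_re_of_mem_cardioid hu]
  have hslope : |u.im / u.re| < 3 * √(3 / 5) := by
    rw [abs_div, abs_of_pos hre, div_lt_iff₀ hre]
    exact abs_im_lt_of_mem_cardioid hu
  rw [arg_eq_arctan hre, abs_lt, ← Real.arctan_neg]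
  exact ⟨Real.arctan_strictMono (abs_lt.mp hslope).1, Real.arctan_strictMono (abs_lt.mp hslope).2⟩

theorem mem_closure_cardioid {x y : ℝ} (h : x ^ 2 + y ^ 2 = 1) :
    (⟨1 / 2 + x + x ^ 2, (1 + x) * y⟩ : ℂ) ∈ closure cardioid := by
  have hz : (⟨x, y⟩ : ℂ) ∈ closure disk := by
    rw [closure_ball 0 one_ne_zero, mem_closedBall_zero_iff, ← sq_le_one_iff₀ (norm_nonneg _),
      Complex.sq_norm, normSq_mk]
    linarith
  have hvalue : (1 + ⟨x, y⟩ + ⟨x, y⟩ ^ 2 / 2 : ℂ) = ⟨1 / 2 + x + x ^ 2, (1 + x) * y⟩ := by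
    apply Complex.ext
    · simp [sq]
      linarith
    · simp [sq]
      ring
  rw [← hvalue]
  exact map_mem_closure (f := fun z : ℂ => 1 + z + z ^ 2 / 2) (by fun_prop) hz
    isBiholomorphism_car.mapsTo

theorem exists_mem_closure_cardioid_re_eq : ∃ u ∈ closure cardioid, u.re = 1 / 4 :=
  ⟨_, mem_closure_cardioid (x := -1 / 2) (y := √3 / 2)
    (by rw [div_pow, div_pow, Real.sq_sqrt (by norm_num)]; norm_num), by norm_num⟩

theorem exists_mem_closure_cardioid_norm_sq_eq :
    ∃ u ∈ closure cardioid, 0 < u.re ∧ ‖u‖ ^ 2 = (3 + √5) / 2 * u.re := by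
  have h5 : √5 ^ 2 = 5 := Real.sq_sqrt (by norm_num)
  have hy : √((5 + √5) / 8) ^ 2 = (5 + √5) / 8 := Real.sq_sqrt (by positivity)
  have hre : 1 / 2 + (√5 - 1) / 4 + ((√5 - 1) / 4) ^ 2 = (5 + √5) / 8 := by
    linear_combination h5 / 16
  refine ⟨_, mem_closure_cardioid (x := (√5 - 1) / 4) (y := √((5 + √5) / 8))
    (by linear_combination hy + h5 / 16), ?_, ?_⟩
  · simp only [hre]
    positivity
  · simp only [Complex.sq_norm, normSq_mk, hre]
    linear_combination (1 + (√5 - 1) / 4) ^ 2 * hy + (√5 / 128 + 5 / 128) * h5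

theorem exists_mem_closure_cardioid_arg_eq :
    ∃ u ∈ closure cardioid, 0 < u.re ∧ arg u = Real.arctan (3 * √(3 / 5)) := by
  have h15 : √15 = 5 * √(3 / 5) := by
    rw [← Real.sqrt_sq (by norm_num : (0 : ℝ) ≤ 5), ← Real.sqrt_mul (by norm_num)]
    norm_num
  have hre : (0 : ℝ) < 1 / 2 + -1 / 4 + (-1 / 4) ^ 2 := by norm_num
  refine ⟨_, mem_closure_cardioid (x := -1 / 4) (y := √15 / 4)
    (by rw [div_pow, div_pow, Real.sq_sqrt (by norm_num)]; norm_num), hre, ?_⟩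
  rw [arg_eq_arctan hre, h15]
  congr 1
  ring

/-! ### Classes containing `𝒮*_car` -/

theorem car_re_pos {z : ℂ} (hz : z ∈ disk) : 0 < (1 + z + z ^ 2 / 2).re := by
  linarith [one_fourth_lt_re_of_mem_cardioid (isBiholomorphism_car.mapsTo hz)]

theorem starCar_subset_starlikeClass_iff {φ : ℂ → ℂ} {Ω : Set ℂ}
    (hφ : IsBiholomorphism φ disk Ω) (hφ0 : φ 0 = 1) :
    starCar ⊆ starlikeClass φ ↔ cardioid ⊆ Ω := by
  rw [starCar, starlikeClass_subset_iff isBiholomorphism_car.analyticOnNhd (by simp)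
    (fun _ => car_re_pos), hφ.subordinate_iff]
  constructor
  · rintro ⟨-, hmaps, -⟩ u hu
    obtain ⟨z, hz, rfl⟩ := isBiholomorphism_car.surjOn hu
    exact hmaps hz
  · exact fun hΩ => ⟨isBiholomorphism_car.analyticOnNhd,
      isBiholomorphism_car.mapsTo.mono_right hΩ, by simp [hφ0]⟩

/-- The image of the unit disk under the Janowski map `z ↦ (1 + A z) / (1 + B z)`, which solves to
`z = (u - 1) / (A - B u)`: an open disk, or an open half-plane when `B = ±1`. -/
def janowskiRegion (A B : ℝ) : Set ℂ :=
  {u | ‖u - 1‖ < ‖A - B * u‖}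

theorem mem_janowskiRegion_iff {A B : ℝ} {u : ℂ} : u ∈ janowskiRegion A B ↔
    (1 - B ^ 2) * ‖u‖ ^ 2 < 2 * (1 - A * B) * u.re - (1 - A ^ 2) := by
  rw [janowskiRegion, mem_ofPred_eq, ← sq_lt_sq₀ (norm_nonneg _) (norm_nonneg _)]
  have hleft : ‖u - 1‖ ^ 2 = ‖u‖ ^ 2 - 2 * u.re + 1 := by
    simp only [Complex.sq_norm, normSq_apply, sub_re, sub_im, one_re, one_im]
    ring
  have hright : ‖A - B * u‖ ^ 2 = A ^ 2 - 2 * A * B * u.re + B ^ 2 * ‖u‖ ^ 2 := by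
    simp only [Complex.sq_norm, normSq_apply, sub_re, sub_im, ofReal_re, ofReal_im, re_ofReal_mul,
      im_ofReal_mul]
    ring
  rw [hleft, hright]
  constructor <;> intro h <;> linarith

theorem one_add_ofReal_mul_ne_zero {B : ℝ} (hB : |B| ≤ 1) {z : ℂ} (hz : z ∈ disk) :
    1 + (B : ℂ) * z ≠ 0 := by
  intro h
  have hnorm : ‖(B : ℂ) * z‖ < 1 := by
    rw [norm_mul, norm_real, Real.norm_eq_abs]
    exact (mul_le_of_le_one_left (norm_nonneg z) hB).trans_lt (mem_ball_zero_iff.mp hz)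
  rw [eq_neg_of_add_eq_zero_right h, norm_neg, norm_one] at hnorm
  exact hnorm.false

theorem isBiholomorphism_janowski {A B : ℝ} (hB : |B| ≤ 1) (hAB : B < A) :
    IsBiholomorphism (fun z => (1 + (A : ℂ) * z) / (1 + (B : ℂ) * z)) disk
      (janowskiRegion A B) := by
  have hz_ne : ∀ z ∈ disk, 1 + (B : ℂ) * z ≠ 0 := fun z hz => one_add_ofReal_mul_ne_zero hB hz
  have hu_ne : ∀ u ∈ janowskiRegion A B, (A : ℂ) - B * u ≠ 0 := fun u hu =>
    norm_pos_iff.mp ((norm_nonneg _).trans_lt hu)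
  have hAB_ne : (A : ℂ) - B ≠ 0 := by exact_mod_cast (sub_pos.mpr hAB).ne'
  have hφ_sub_one : ∀ z ∈ disk,
      (1 + A * z) / (1 + B * z) - 1 = (A - B) * z / (1 + B * z) := fun z hz => by
    rw [div_sub_one (hz_ne z hz)]
    ring
  have hsub_mul_φ : ∀ z ∈ disk,
      (A : ℂ) - B * ((1 + A * z) / (1 + B * z)) = (A - B) / (1 + B * z) := fun z hz => by
    rw [eq_div_iff (hz_ne z hz), sub_mul, mul_assoc, div_mul_cancel₀ _ (hz_ne z hz)]
    ring
  have hone_add_mul_ψ : ∀ C : ℝ, ∀ u ∈ janowskiRegion A B,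
      1 + C * ((u - 1) / (A - B * u)) = ((A - C) + (C - B) * u) / (A - B * u) := fun C u hu => by
    rw [eq_div_iff (hu_ne u hu), add_mul, mul_assoc, div_mul_cancel₀ _ (hu_ne u hu)]
    ring
  refine ⟨fun z hz => AnalyticAt.fun_div (by fun_prop) (by fun_prop) (hz_ne z hz), fun z hz => ?_,
    fun u => (u - 1) / (A - B * u),
    fun u hu => AnalyticAt.fun_div (by fun_prop) (by fun_prop) (hu_ne u hu),
    fun u hu => ?_, fun z hz => ?_, fun u hu => ?_⟩
  · rw [janowskiRegion, mem_ofPred_eq, hφ_sub_one z hz, hsub_mul_φ z hz, norm_div, norm_div,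
      norm_mul]
    exact div_lt_div_of_pos_right (mul_lt_of_lt_one_right (norm_pos_iff.mpr hAB_ne)
      (mem_ball_zero_iff.mp hz)) (norm_pos_iff.mpr (hz_ne z hz))
  · rw [mem_ball_zero_iff, norm_div]
    exact (div_lt_one (norm_pos_iff.mpr (hu_ne u hu))).mpr hu
  · simp only [hφ_sub_one z hz, hsub_mul_φ z hz]
    rw [div_div_div_cancel_right₀ (hz_ne z hz), mul_div_cancel_left₀ _ hAB_ne]
  · simp only [hone_add_mul_ψ A u hu, hone_add_mul_ψ B u hu, sub_self, zero_add, zero_mul, add_zero]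
    rw [div_div_div_cancel_right₀ (hu_ne u hu), mul_div_cancel_left₀ _ hAB_ne]

theorem starCar_subset_janowski_iff {A B : ℝ} (hB : |B| ≤ 1) (hAB : B < A) :
    starCar ⊆ janowski A B ↔ cardioid ⊆ janowskiRegion A B :=
  starCar_subset_starlikeClass_iff (isBiholomorphism_janowski hB hAB) (by simp)

theorem starCar_subset_starlikeOfOrder_iff {α : ℝ} (hα : α < 1) :
    starCar ⊆ starlikeOfOrder α ↔ α ≤ 1 / 4 := by
  have hregion : ∀ u : ℂ, u ∈ janowskiRegion (1 - 2 * α) (-1) ↔ α < u.re := fun u => by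
    rw [mem_janowskiRegion_iff, ← mul_lt_mul_iff_right₀ (b := α) (sub_pos.mpr hα)]
    constructor <;> intro h <;> linarith
  rw [starlikeOfOrder, starCar_subset_janowski_iff (by norm_num) (by linarith)]
  constructor
  · intro hsub
    obtain ⟨u, hu, hure⟩ := exists_mem_closure_cardioid_re_eq
    rw [← hure]
    exact ContinuousWithinAt.closure_le hu continuousWithinAt_const
      continuous_re.continuousWithinAt fun v hv => ((hregion v).mp (hsub hv)).le
  · exact fun h u hu => (hregion u).mpr (h.trans_lt (one_fourth_lt_re_of_mem_cardioid hu))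

theorem mem_janowskiRegion_one_iff {M : ℝ} (hM : 1 / 2 < M) {u : ℂ} :
    u ∈ janowskiRegion 1 (-(M - 1) / M) ↔ ‖u‖ ^ 2 < 2 * M * u.re := by
  have hM_ne : M ≠ 0 := by linarith
  have hscale : 0 < (2 * M - 1) / M ^ 2 := div_pos (by linarith) (by positivity)
  rw [mem_janowskiRegion_iff, ← mul_lt_mul_iff_right₀ (b := ‖u‖ ^ 2) hscale]
  have hleft : (1 - (-(M - 1) / M) ^ 2) * ‖u‖ ^ 2 = (2 * M - 1) / M ^ 2 * ‖u‖ ^ 2 := by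
    field_simp
    ring
  have hright : 2 * (1 - 1 * (-(M - 1) / M)) * u.re - (1 - 1 ^ 2) =
      (2 * M - 1) / M ^ 2 * (2 * M * u.re) := by
    field_simp
    ring
  rw [hleft, hright]

theorem starCar_subset_janowski_one_iff {M : ℝ} (hM : 1 / 2 < M) :
    starCar ⊆ janowski 1 (-(M - 1) / M) ↔ (3 + √5) / 4 ≤ M := by
  have hB_abs : |-(M - 1) / M| ≤ 1 := by
    rw [abs_div, abs_of_pos (by linarith : 0 < M), div_le_one (by linarith), abs_le]
    constructor <;> linarith
  have hB_lt : -(M - 1) / M < 1 := by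
    rw [div_lt_one (by linarith)]
    linarith
  rw [starCar_subset_janowski_iff hB_abs hB_lt]
  constructor
  · intro hsub
    obtain ⟨u, hu, hure, hu_norm⟩ := exists_mem_closure_cardioid_norm_sq_eq
    have hle : ‖u‖ ^ 2 ≤ 2 * M * u.re :=
      ContinuousWithinAt.closure_le hu (continuous_norm.pow 2).continuousWithinAt
        (continuous_const.mul continuous_re).continuousWithinAt
        fun v hv => ((mem_janowskiRegion_one_iff hM).mp (hsub hv)).le
    rw [hu_norm] at hle
    linarith [le_of_mul_le_mul_right hle hure]
  · intro h u hu
    have hure := one_fourth_lt_re_of_mem_cardioid hu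
    rw [mem_janowskiRegion_one_iff hM]
    calc ‖u‖ ^ 2 < (3 + √5) / 2 * u.re := norm_sq_lt_of_mem_cardioid hu
      _ ≤ 2 * M * u.re := by gcongr; linarith

theorem isBiholomorphism_stronglyStarlike {β : ℝ} (hβ : 0 < β) (hβ1 : β ≤ 1) :
    IsBiholomorphism (fun z => ((1 + z) / (1 - z)) ^ (β : ℂ)) disk
      (sector (β * (Real.pi / 2))) := by
  have hhalf_plane : janowskiRegion 1 (-1) = sector (Real.pi / 2) := by
    ext u
    rw [mem_janowskiRegion_iff, mem_sector_pi_div_two_iff]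
    constructor <;> intro h <;> linarith
  have hjanowski := isBiholomorphism_janowski (A := 1) (B := -1) (by norm_num) (by norm_num)
  simp only [hhalf_plane, ofReal_one, ofReal_neg, one_mul, neg_one_mul, ← sub_eq_add_neg]
    at hjanowski
  have hπ := Real.pi_pos
  exact (isBiholomorphism_cpow hβ (by linarith) (by nlinarith)).comp hjanowski

theorem two_div_pi_mul_arctan_mem_Ioo {x : ℝ} (hx : 0 < x) :
    2 / Real.pi * Real.arctan x ∈ Ioo (0 : ℝ) 1 := by
  have hπ := Real.pi_pos
  refine ⟨mul_pos (by positivity) (Real.arctan_pos.mpr hx), ?_⟩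
  rw [div_mul_eq_mul_div, div_lt_one hπ]
  linarith [Real.arctan_lt_pi_div_two x]

theorem starCar_subset_stronglyStarlike_iff {β : ℝ} (hβ : 0 < β) (hβ1 : β ≤ 1) :
    starCar ⊆ stronglyStarlike β ↔ 2 / Real.pi * Real.arctan (3 * √(3 / 5)) ≤ β := by
  have hscale : 2 / Real.pi * Real.arctan (3 * √(3 / 5)) ≤ β ↔
      Real.arctan (3 * √(3 / 5)) ≤ β * (Real.pi / 2) := by
    rw [← div_le_iff₀ (by positivity), div_div_eq_mul_div, div_mul_eq_mul_div, mul_comm]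
  rw [stronglyStarlike, starCar_subset_starlikeClass_iff
    (isBiholomorphism_stronglyStarlike hβ hβ1) (by simp), hscale]
  constructor
  · intro hsub
    obtain ⟨u, hu, hure, harg⟩ := exists_mem_closure_cardioid_arg_eq
    rw [← harg]
    exact ContinuousWithinAt.closure_le hu (continuousAt_arg (Or.inl hure)).continuousWithinAt
      continuousWithinAt_const fun v hv => (le_abs_self _).trans (hsub hv).2.le
  · intro h u hu
    have hure := one_fourth_lt_re_of_mem_cardioid hu
    refine ⟨fun hu0 => ?_, (abs_arg_lt_of_mem_cardioid hu).trans_le h⟩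
    norm_num [hu0] at hure

/-! ### Subregions of the cardioid -/

theorem ball_three_halves_subset_cardioid : ball ((3 / 2 : ℝ) : ℂ) 1 ⊆ cardioid := fun u hu => by
  rw [mem_ball_ofReal_iff zero_le_one] at hu
  rw [mem_cardioid_iff]
  have hu_norm := four_mul_norm_sq u
  have hre_le : 2 * u.re - 1 ≤ ‖2 * u - 1‖ := by simpa using re_le_norm (2 * u - 1)
  set R := ‖2 * u - 1‖
  have hR : R < 4 := by nlinarith
  linarith [mul_nonneg (norm_nonneg (2 * u - 1)) (sub_pos.mpr hR).le]

theorem half_disk_subset_cardioid :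
    ball ((5 / 4 : ℝ) : ℂ) (5 / 4) ∩ {u | 1 / 2 < u.re} ⊆ cardioid := fun u ⟨hu, hre⟩ => by
  rw [mem_ball_ofReal_iff (by norm_num)] at hu
  rw [mem_ofPred_eq] at hre
  rw [mem_cardioid_iff]
  have hu_norm := four_mul_norm_sq u
  have hre_le : 2 * u.re - 1 ≤ ‖2 * u - 1‖ := by simpa using re_le_norm (2 * u - 1)
  set R := ‖2 * u - 1‖
  have hR : R < 4 := by nlinarith
  rcases le_total R 2 with hR2 | hR2
  · linarith [mul_nonneg (norm_nonneg (2 * u - 1)) (sub_nonneg.mpr hR2)]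
  · linarith [mul_nonneg (sub_nonneg.mpr hR2) (sub_pos.mpr hR).le]

theorem one_half_lt_of_ofReal_mem_cardioid {x : ℝ} (hx : (x : ℂ) ∈ cardioid) : 1 / 2 < x := by
  have hre := one_fourth_lt_re_of_mem_cardioid hx
  rw [mem_cardioid_iff, (by push_cast; rfl : 2 * (x : ℂ) - 1 = ((2 * x - 1 : ℝ) : ℂ)), norm_real,
    Real.norm_eq_abs, ofReal_re, sq_abs] at hx
  rw [ofReal_re] at hre
  by_contra! hle
  rw [abs_of_nonpos (by linarith)] at hx
  nlinarith

theorem one_half_le_of_mapsTo_cardioid {φ : ℂ → ℂ} {r : ℝ → ℝ} (hφ : MapsTo φ disk cardioid)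
    (hr : Continuous r) (hφr : ∀ x ∈ Ioo (-1 : ℝ) 1, φ x = r x) : 1 / 2 ≤ r (-1) := by
  have hclosure : (-1 : ℝ) ∈ closure (Ioo (-1 : ℝ) 1) := by
    rw [closure_Ioo (by norm_num)]
    norm_num
  refine ContinuousWithinAt.closure_le hclosure continuousWithinAt_const hr.continuousWithinAt
    fun x hx => (one_half_lt_of_ofReal_mem_cardioid ?_).le
  rw [← hφr x hx]
  exact hφ (by rw [mem_ball_zero_iff, norm_real, Real.norm_eq_abs]; exact abs_lt.mpr hx)

theorem mem_cardioid_of_norm_sub_one_lt {u : ℂ} (hu : 5 / 3 * ‖u - 1‖ < u.re) :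
    u ∈ cardioid := by
  have hsub : 4 * ‖u - 1‖ ^ 2 = ‖2 * u - 1‖ ^ 2 - 4 * u.re + 3 := by
    simp only [Complex.sq_norm, normSq_apply, sub_re, sub_im, mul_re, mul_im, re_ofNat, im_ofNat,
      one_re, one_im]
    ring
  have hconic : 100 * ‖u - 1‖ ^ 2 < 36 * u.re ^ 2 := by nlinarith [norm_nonneg (u - 1)]
  have hre_le : 2 * u.re - 1 ≤ ‖2 * u - 1‖ := by simpa using re_le_norm (2 * u - 1)
  rw [mem_cardioid_iff]
  have hR := norm_nonneg (2 * u - 1)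
  have hre : 0 < u.re := (by positivity : 0 ≤ 5 / 3 * ‖u - 1‖).trans_lt hu
  set R := ‖2 * u - 1‖
  by_contra! hle
  have hcubic : 0 < (R - 4) * (9 * R ^ 3 + 72 * R + 16) := by nlinarith
  have hR4 : 4 < R := sub_pos.mp (pos_of_mul_pos_left hcubic (by positivity))
  nlinarith [mul_pos (sub_pos.mpr hR4) (by linarith : 0 < 4 * R - 1)]

/-! ### Classes contained in `𝒮*_car` -/

theorem starlikeClass_subset_starCar_iff {φ : ℂ → ℂ} (hφ : AnalyticOnNhd ℂ φ disk)
    (hφ0 : φ 0 = 1) (hpos : ∀ z ∈ disk, 0 < (φ z).re) :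
    starlikeClass φ ⊆ starCar ↔ MapsTo φ disk cardioid := by
  rw [starCar, starlikeClass_subset_iff hφ hφ0 hpos, isBiholomorphism_car.subordinate_iff]
  simp [hφ, hφ0]

theorem ball_ofReal_subset_ball_ofReal {c c' r r' : ℝ} (h : r + |c - c'| ≤ r') :
    ball (c : ℂ) r ⊆ ball (c' : ℂ) r' :=
  ball_subset_ball' (by rwa [isometry_ofReal.dist_eq])

theorem janowskiRegion_eq_ball {A B : ℝ} (hB : |B| < 1) (hAB : B < A) : janowskiRegion A B =
    ball (((1 - A * B) / (1 - B ^ 2) : ℝ) : ℂ) ((A - B) / (1 - B ^ 2)) := by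
  have hden : 0 < 1 - B ^ 2 := sub_pos.mpr ((sq_lt_one_iff_abs_lt_one B).mpr hB)
  ext u
  rw [mem_janowskiRegion_iff, mem_ball_ofReal_iff (div_pos (sub_pos.mpr hAB) hden).le,
    ← lt_div_iff₀' hden]
  have hright : (2 * (1 - A * B) * u.re - (1 - A ^ 2)) / (1 - B ^ 2) =
      2 * ((1 - A * B) / (1 - B ^ 2)) * u.re +
        (((A - B) / (1 - B ^ 2)) ^ 2 - ((1 - A * B) / (1 - B ^ 2)) ^ 2) := by
    field_simp
    ring
  rw [hright]

theorem janowski_subset_starCar {A B : ℝ} (hB : -1 < B) (hAB : B < A) (hleft : 2 * A ≤ 1 + B)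
    (hright : 2 * A ≤ 3 + 5 * B) : janowski A B ⊆ starCar := by
  have hB_abs : |B| < 1 := abs_lt.mpr ⟨hB, by linarith⟩
  have hden : 0 < 1 - B ^ 2 := sub_pos.mpr ((sq_lt_one_iff_abs_lt_one B).mpr hB_abs)
  have hball : janowskiRegion A B ⊆ cardioid := by
    rw [janowskiRegion_eq_ball hB_abs hAB]
    refine (ball_ofReal_subset_ball_ofReal ?_).trans ball_three_halves_subset_cardioid
    rw [← le_sub_iff_add_le', abs_le]
    have hlower : 1 / 2 ≤ (1 - A * B) / (1 - B ^ 2) - (A - B) / (1 - B ^ 2) := by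
      rw [← sub_div, le_div_iff₀ hden]
      nlinarith
    have hupper : (1 - A * B) / (1 - B ^ 2) + (A - B) / (1 - B ^ 2) ≤ 5 / 2 := by
      rw [← add_div, div_le_iff₀ hden]
      nlinarith
    constructor <;> linarith
  have hφ := isBiholomorphism_janowski hB_abs.le hAB
  have hmaps := hφ.mapsTo.mono_right hball
  refine (starlikeClass_subset_starCar_iff hφ.analyticOnNhd (by simp) fun z hz => ?_).mpr hmaps
  linarith [one_fourth_lt_re_of_mem_cardioid (hmaps hz)]

theorem one_add_mem_slitPlane_of_mem_disk {z : ℂ} (hz : z ∈ disk) : 1 + z ∈ slitPlane :=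
  Or.inl (re_pos_of_mem_ball_one (by simpa using hz))

theorem cpow_one_half_one_add_mem_ball {z : ℂ} (hz : z ∈ disk) :
    (1 + z) ^ (1 / 2 : ℂ) ∈ ball (1 : ℂ) 1 := by
  have hre := re_cpow_one_half_pos (one_add_mem_slitPlane_of_mem_disk hz)
  have hsq := cpow_one_half_sq (1 + z)
  set s := (1 + z) ^ (1 / 2 : ℂ)
  have hfactor : (s - 1) * (s + 1) = z := by linear_combination hsq
  have hone_le : 1 ≤ ‖s + 1‖ := by
    have := re_le_norm (s + 1)
    rw [add_re, one_re] at this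
    linarith
  rw [mem_ball_iff_norm]
  calc ‖s - 1‖ ≤ ‖s - 1‖ * ‖s + 1‖ := le_mul_of_one_le_right (norm_nonneg _) hone_le
    _ = ‖z‖ := by rw [← norm_mul, hfactor]
    _ < 1 := mem_ball_zero_iff.mp hz

theorem cpow_one_half_one_add_ofReal {x : ℝ} (hx : -1 ≤ x) :
    (1 + (x : ℂ)) ^ (1 / 2 : ℂ) = √(1 + x) := by
  rw [Real.sqrt_eq_rpow, ofReal_cpow (by linarith)]
  norm_num

theorem analyticOnNhd_cpow_one_half_one_add :
    AnalyticOnNhd ℂ (fun z => (1 + z) ^ (1 / 2 : ℂ)) disk := fun _ hz =>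
  AnalyticAt.cpow (by fun_prop) analyticAt_const (one_add_mem_slitPlane_of_mem_disk hz)

theorem starLemniscate_subset_starCar_iff {α : ℝ} (hα : 0 ≤ α) (hα1 : α < 1) :
    starLemniscate α ⊆ starCar ↔ 1 / 2 ≤ α := by
  have hball : ∀ z ∈ disk,
      (α : ℂ) + (1 - α) * (1 + z) ^ (1 / 2 : ℂ) ∈ ball (1 : ℂ) (1 - α) := fun z hz => by
    have hs := mem_ball_iff_norm.mp (cpow_one_half_one_add_mem_ball hz)
    set s := (1 + z) ^ (1 / 2 : ℂ)
    have hsub : (α : ℂ) + (1 - α) * s - 1 = ((1 - α : ℝ) : ℂ) * (s - 1) := by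
      push_cast
      ring
    rw [mem_ball_iff_norm, hsub, norm_mul, norm_real, Real.norm_of_nonneg (sub_pos.mpr hα1).le]
    exact mul_lt_of_lt_one_right (sub_pos.mpr hα1) hs
  have hanalytic : AnalyticOnNhd ℂ (fun z => (α : ℂ) + (1 - α) * (1 + z) ^ (1 / 2 : ℂ)) disk :=
    fun z hz => analyticAt_const.add
      (analyticAt_const.mul (analyticOnNhd_cpow_one_half_one_add z hz))
  rw [starLemniscate, starlikeClass_subset_starCar_iff hanalytic (by simp)
    fun z hz => re_pos_of_mem_ball_one (ball_subset_ball (by linarith) (hball z hz))]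
  constructor
  · intro hmaps
    have hvalue := one_half_le_of_mapsTo_cardioid hmaps
      (r := fun x => α + (1 - α) * √(1 + x)) (by fun_prop) fun x hx => by
        rw [cpow_one_half_one_add_ofReal hx.1.le]
        norm_cast
    simpa using hvalue
  · intro h z hz
    refine ball_three_halves_subset_cardioid
      (ball_ofReal_subset_ball_ofReal ?_ (ofReal_one ▸ hball z hz))
    rw [abs_of_neg (by norm_num)]
    linarith

theorem starCassini_subset_starCar_iff {c : ℝ} (hc : 0 < c) (hc1 : c ≤ 1) :
    starCassini c ⊆ starCar ↔ c ≤ 3 / 4 := by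
  have hcz : ∀ z ∈ disk, ‖(c : ℂ) * z‖ < c := fun z hz => by
    rw [norm_mul, norm_real, Real.norm_of_nonneg hc.le]
    exact mul_lt_of_lt_one_right hc (mem_ball_zero_iff.mp hz)
  have hcz_mem : ∀ z ∈ disk, (c : ℂ) * z ∈ disk := fun z hz =>
    mem_ball_zero_iff.mpr ((hcz z hz).trans_le hc1)
  have hanalytic : AnalyticOnNhd ℂ (fun z => (1 + (c : ℂ) * z) ^ (1 / 2 : ℂ)) disk :=
    analyticOnNhd_cpow_one_half_one_add.comp (fun z _ => by fun_prop) hcz_mem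
  rw [starCassini, starlikeClass_subset_starCar_iff hanalytic (by simp)
    fun z hz => re_pos_of_mem_ball_one (cpow_one_half_one_add_mem_ball (hcz_mem z hz))]
  constructor
  · intro hmaps
    have hvalue := one_half_le_of_mapsTo_cardioid hmaps
      (r := fun x => √(1 + c * x)) (by fun_prop) fun x hx => by
        rw [← ofReal_mul, cpow_one_half_one_add_ofReal (by nlinarith [hx.1])]
    rw [Real.le_sqrt' (by norm_num)] at hvalue
    linarith
  · intro h z hz
    have hre := re_cpow_one_half_pos (one_add_mem_slitPlane_of_mem_disk (hcz_mem z hz))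
    have hsq := congrArg re (cpow_one_half_sq (1 + c * z))
    have hs := cpow_one_half_one_add_mem_ball (hcz_mem z hz)
    have hcz_re := (abs_lt.mp ((abs_re_le_norm (c * z)).trans_lt (hcz z hz))).1
    refine half_disk_subset_cardioid
      ⟨ball_ofReal_subset_ball_ofReal ?_ (ofReal_one ▸ hs), ?_⟩
    · norm_num [abs_of_neg]
    · rw [sq, mul_re, add_re, one_re] at hsq
      exact lt_of_pow_lt_pow_left₀ 2 hre.le
        (by nlinarith [mul_self_nonneg ((1 + c * z) ^ (1 / 2 : ℂ)).im])

theorem one_add_sq_div_two_lt_cos_im {z : ℂ} (hz : z ∈ disk) :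
    (1 + z.re ^ 2) / 2 < Real.cos z.im := by
  have hnorm := (sq_lt_one_iff₀ (norm_nonneg z)).mpr (mem_ball_zero_iff.mp hz)
  rw [Complex.sq_norm, normSq_apply] at hnorm
  linarith [Real.one_sub_sq_div_two_le_cos (x := z.im)]

theorem exp_neg_one_lt_exp_re {z : ℂ} (hz : z ∈ disk) : Real.exp (-1) < (exp z).re := by
  have hcos := one_add_sq_div_two_lt_cos_im hz
  have hx := (abs_lt.mp ((abs_re_le_norm z).trans_lt (mem_ball_zero_iff.mp hz))).1
  rw [exp_re]
  generalize z.re = x at hx hcos ⊢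
  have hexp := Real.quadratic_le_exp_of_nonneg (by linarith : 0 ≤ 1 + x)
  calc Real.exp (-1)
      ≤ Real.exp (-1) * ((1 + (1 + x) + (1 + x) ^ 2 / 2) * ((1 + x ^ 2) / 2)) := by
        refine le_mul_of_one_le_right (Real.exp_pos _).le ?_
        have hproduct : (1 + (1 + x) + (1 + x) ^ 2 / 2) * ((1 + x ^ 2) / 2) =
            1 + (1 + x) ^ 4 / 4 := by ring
        rw [hproduct, le_add_iff_nonneg_right]
        positivity
    _ ≤ Real.exp (-1) * (Real.exp (1 + x) * ((1 + x ^ 2) / 2)) := by gcongr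
    _ = Real.exp x * ((1 + x ^ 2) / 2) := by rw [← mul_assoc, ← Real.exp_add, neg_add_cancel_left]
    _ < Real.exp x * Real.cos z.im := by gcongr

theorem exp_mem_ball {z : ℂ} (hz : z ∈ disk) : exp z ∈ ball ((21 / 16 : ℝ) : ℂ) (25 / 16) := by
  have hcos := one_add_sq_div_two_lt_cos_im hz
  obtain ⟨-, hx1⟩ := abs_lt.mp ((abs_re_le_norm z).trans_lt (mem_ball_zero_iff.mp hz))
  rw [mem_ball_ofReal_iff (by norm_num), norm_exp, exp_re]
  generalize z.re = x at hx1 hcos ⊢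
  have hgap : Real.exp x - 21 / 16 * (1 + x ^ 2) ≤ 13 / 50 := by
    rcases le_total x 0 with hx | hx
    · linarith [Real.exp_le_one_iff.mpr hx, sq_nonneg x]
    · have hchord : Real.exp x ≤ 1 + (Real.exp 1 - 1) * x := by
        have := convexOn_exp.2 (mem_univ 0) (mem_univ 1) (sub_nonneg.mpr hx1.le) hx
          (sub_add_cancel 1 x)
        simp only [smul_eq_mul, mul_zero, mul_one, zero_add, Real.exp_zero] at this
        linarith
      nlinarith [Real.exp_one_lt_d9, sq_nonneg (x - 13 / 20)]
  have hexp_lt : Real.exp x < 68 / 25 :=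
    (Real.exp_lt_exp.mpr hx1).trans (Real.exp_one_lt_d9.trans (by norm_num))
  have hexp_pos := Real.exp_pos x
  calc Real.exp x ^ 2
      = Real.exp x * (Real.exp x - 21 / 16 * (1 + x ^ 2)) +
        21 / 8 * (Real.exp x * ((1 + x ^ 2) / 2)) := by ring
    _ < 68 / 25 * (13 / 50) + 21 / 8 * (Real.exp x * Real.cos z.im) := by
        refine add_lt_add_of_le_of_lt ?_ (by gcongr)
        exact (mul_le_mul_of_nonneg_left hgap hexp_pos.le).trans (by linarith)
    _ ≤ _ := by linarith

theorem exp_one_sub_two_div_mem_Ioo :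
    (Real.exp 1 - 2) / (2 * (Real.exp 1 - 1)) ∈ Ioo (0 : ℝ) 1 := by
  have he : 2 < Real.exp 1 := (by norm_num : (2 : ℝ) < _).trans Real.exp_one_gt_d9
  exact ⟨div_pos (by linarith) (by linarith), (div_lt_one (by linarith)).mpr (by linarith)⟩

theorem starExp_subset_starCar_iff {α : ℝ} (hα : 0 ≤ α) (hα1 : α < 1) :
    starExp α ⊆ starCar ↔ (Real.exp 1 - 2) / (2 * (Real.exp 1 - 1)) ≤ α := by
  have he : 8 / 3 < Real.exp 1 := (by norm_num : (8 / 3 : ℝ) < _).trans Real.exp_one_gt_d9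
  have hcusp : 1 / 2 ≤ α + (1 - α) * Real.exp (-1) ↔
      (Real.exp 1 - 2) / (2 * (Real.exp 1 - 1)) ≤ α := by
    rw [Real.exp_neg, ← div_eq_mul_inv, ← sub_le_iff_le_add', le_div_iff₀ (Real.exp_pos 1),
      div_le_iff₀ (by linarith)]
    constructor <;> intro h <;> linarith
  have hre : ∀ z ∈ disk, α + (1 - α) * Real.exp (-1) < (α + (1 - α) * exp z : ℂ).re := by
    intro z hz
    rw [add_re, ofReal_re, ← ofReal_one, ← ofReal_sub, re_ofReal_mul]
    exact add_lt_add_right (mul_lt_mul_of_pos_left (exp_neg_one_lt_exp_re hz) (sub_pos.mpr hα1)) _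
  rw [starExp, starlikeClass_subset_starCar_iff (fun z _ => by fun_prop) (by simp)
    (fun z hz => (hre z hz).trans' (by have := sub_pos.mpr hα1; positivity)), ← hcusp]
  constructor
  · exact fun hmaps => one_half_le_of_mapsTo_cardioid hmaps
      (r := fun x => α + (1 - α) * Real.exp x) (by fun_prop) fun x _ => by push_cast; rfl
  · intro h z hz
    refine half_disk_subset_cardioid ⟨?_, h.trans_lt (hre z hz)⟩
    have hα5 : 1 / 5 ≤ α := by
      refine le_trans ?_ (hcusp.mp h)
      rw [le_div_iff₀ (by linarith)]
      linarith
    have hdecomp : (α + (1 - α) * exp z : ℂ) - (5 / 4 : ℝ) =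
        ((1 - α : ℝ) : ℂ) * (exp z - (21 / 16 : ℝ)) + (((1 - 5 * α) / 16 : ℝ) : ℂ) := by
      push_cast
      ring
    rw [mem_ball_iff_norm, hdecomp]
    calc _ ≤ ‖((1 - α : ℝ) : ℂ) * (exp z - (21 / 16 : ℝ))‖ + ‖(((1 - 5 * α) / 16 : ℝ) : ℂ)‖ :=
          norm_add_le _ _
      _ = (1 - α) * ‖exp z - (21 / 16 : ℝ)‖ + (5 * α - 1) / 16 := by
          rw [norm_mul, norm_real, norm_real, Real.norm_of_nonneg (by linarith),
            Real.norm_of_nonpos (by linarith)]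
          ring
      _ < (1 - α) * (25 / 16) + (5 * α - 1) / 16 := by
          have := mul_lt_mul_of_pos_left (mem_ball_iff_norm.mp (exp_mem_ball hz))
            (sub_pos.mpr hα1)
          linarith
      _ ≤ 5 / 4 := by linarith

theorem kStarlike_subset_starCar {k : ℝ} (hk : 5 / 3 ≤ k) : kStarlike k ⊆ starCar := by
  rintro f ⟨hf, hfk⟩
  have hconic : ∀ z ∈ disk, 5 / 3 * ‖starQuotient f z - 1‖ < (starQuotient f z).re := fun z hz =>
    (by gcongr : 5 / 3 * ‖starQuotient f z - 1‖ ≤ _).trans_lt (hfk z hz)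
  obtain ⟨hfS, hanalytic⟩ := mem_classS_and_analyticOnNhd_starQuotient hf fun z hz =>
    (hconic z hz).trans_le' (by positivity)
  exact ⟨hfS, isBiholomorphism_car.subordinate_iff.mpr
    ⟨hanalytic, fun z hz => mem_cardioid_of_norm_sub_one_lt (hconic z hz), by simp [starQuotient]⟩⟩

theorem mul_norm_cayley_lt_re {k L : ℝ} (hk : 0 ≤ k) (hL : 0 ≤ L) (hL2 : L ≤ 2)
    (hkL : (k - 1) * L ≤ 1) {q : ℂ} (hq : q ∈ ball (1 : ℂ) 1) (hq_sq : ‖1 - q ^ 2‖ < 1) :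
    k * ‖L * ((1 - q) / (1 + q))‖ < (1 + L * ((1 - q) / (1 + q))).re := by
  have hq_norm : ‖q‖ ^ 2 < 2 * q.re := by
    rw [← ofReal_one, mem_ball_ofReal_iff zero_le_one] at hq
    linarith
  have hden : 0 < ‖1 + q‖ := norm_pos_iff.mpr fun h => by
    have := congrArg re h
    rw [add_re, one_re, zero_re] at this
    linarith [re_pos_of_mem_ball_one hq]
  have hleft : ‖1 + q‖ ^ 2 * (k * ‖L * ((1 - q) / (1 + q))‖) = k * L * ‖1 - q ^ 2‖ := by
    rw [(by ring : 1 - q ^ 2 = (1 - q) * (1 + q)), norm_mul, norm_mul, norm_div, norm_real,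
      Real.norm_of_nonneg hL]
    field_simp
  have hright : ‖1 + q‖ ^ 2 * (1 + L * ((1 - q) / (1 + q))).re =
      1 + L + 2 * q.re + (1 - L) * ‖q‖ ^ 2 := by
    have hnorm : ‖1 + q‖ ^ 2 = 1 + 2 * q.re + ‖q‖ ^ 2 := by
      simp only [Complex.sq_norm, normSq_apply, add_re, add_im, one_re, one_im]
      ring
    have hcayley : ‖1 + q‖ ^ 2 * ((1 - q) / (1 + q)).re = 1 - ‖q‖ ^ 2 := by
      rw [div_re, ← Complex.sq_norm, ← add_div, mul_div_cancel₀ _ (pow_pos hden 2).ne',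
        Complex.sq_norm, normSq_apply]
      simp only [sub_re, add_re, sub_im, add_im, one_re, one_im]
      ring
    rw [add_re, one_re, re_ofReal_mul]
    linear_combination L * hcayley + hnorm
  rw [← mul_lt_mul_iff_right₀ (pow_pos hden 2), hleft, hright]
  have : k * L * ‖1 - q ^ 2‖ ≤ k * L := mul_le_of_le_one_right (by positivity) hq_sq.le
  nlinarith [mul_nonneg (sub_nonneg.mpr hL2) (sq_nonneg ‖q‖)]

/-- The map `z ↦ 1 + L (1 - √(1 - z)) / (1 + √(1 - z))`, an explicit substitute for the extremal
function of the conic domain `k |u - 1| < Re u`: for suitable `L` it takes values in that domain and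
still attains the boundary point `5 / 2` of the cardioid. -/
noncomputable def conicMap (L : ℝ) (z : ℂ) : ℂ :=
  1 + L * ((1 - (1 + -z) ^ (1 / 2 : ℂ)) / (1 + (1 + -z) ^ (1 / 2 : ℂ)))

theorem neg_mem_disk {z : ℂ} (hz : z ∈ disk) : -z ∈ disk := by simpa using hz

theorem differentiableOn_conicMap (L : ℝ) : DifferentiableOn ℂ (conicMap L) disk := by
  have hroot : DifferentiableOn ℂ (fun z => (1 + -z) ^ (1 / 2 : ℂ)) disk :=
    analyticOnNhd_cpow_one_half_one_add.differentiableOn.comp differentiableOn_id.neg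
      fun _ hz => neg_mem_disk hz
  have hden : ∀ z ∈ disk, 1 + (1 + -z) ^ (1 / 2 : ℂ) ≠ 0 := fun z hz h => by
    have := re_pos_of_mem_ball_one (cpow_one_half_one_add_mem_ball (neg_mem_disk hz))
    rw [eq_neg_of_add_eq_zero_right h] at this
    norm_num at this
  unfold conicMap
  fun_prop (disch := assumption)

theorem mul_norm_conicMap_sub_one_lt_re {k L : ℝ} (hk : 0 ≤ k) (hL : 0 ≤ L) (hL2 : L ≤ 2)
    (hkL : (k - 1) * L ≤ 1) {z : ℂ} (hz : z ∈ disk) :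
    k * ‖conicMap L z - 1‖ < (conicMap L z).re := by
  rw [conicMap, add_sub_cancel_left]
  refine mul_norm_cayley_lt_re hk hL hL2 hkL (cpow_one_half_one_add_mem_ball (neg_mem_disk hz)) ?_
  rwa [cpow_one_half_sq, sub_add_cancel_left, neg_neg, ← mem_ball_zero_iff]

theorem exists_conicMap_eq {L : ℝ} (hL : 3 / 2 < L) : ∃ z ∈ disk, conicMap L z = (5 / 2 : ℝ) := by
  obtain ⟨q, hq, hq1, hLq⟩ : ∃ q : ℝ, 0 < q ∧ q < 1 ∧ L * (1 - q) = 3 / 2 * (1 + q) :=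
    ⟨(L - 3 / 2) / (L + 3 / 2), div_pos (by linarith) (by linarith),
      (div_lt_one (by linarith)).mpr (by linarith), by field_simp; ring⟩
  refine ⟨(1 - q ^ 2 : ℝ), ?_, ?_⟩
  · rw [mem_ball_zero_iff, norm_real, Real.norm_of_nonneg (by nlinarith)]
    nlinarith
  · have hroot : (1 + -((1 - q ^ 2 : ℝ) : ℂ)) ^ (1 / 2 : ℂ) = q := by
      rw [← sq_cpow_one_half (u := q) (by simpa using hq)]
      push_cast
      ring_nf
    rw [conicMap, hroot]
    norm_cast
    rw [← mul_div_assoc, hLq, mul_div_cancel_right₀ _ (by linarith)]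
    norm_num

theorem exists_mem_kStarlike_notMem_starCar {k : ℝ} (hk : 0 ≤ k) (hk' : k < 5 / 3) :
    ∃ f ∈ kStarlike k, f ∉ starCar := by
  obtain ⟨L, hL, hL2, hkL⟩ : ∃ L : ℝ, 3 / 2 < L ∧ L ≤ 2 ∧ (k - 1) * L ≤ 1 :=
    ⟨2 - 3 * k / 10, by linarith, by linarith, by nlinarith⟩
  obtain ⟨f, hf, hfL⟩ := exists_mem_classA_eqOn_starQuotient (differentiableOn_conicMap L)
    (by simp [conicMap])
  refine ⟨f, ⟨hf, fun z hz => ?_⟩, fun hcar => ?_⟩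
  · rw [hfL hz]
    exact mul_norm_conicMap_sub_one_lt_re hk (by linarith) hL2 hkL hz
  · obtain ⟨z, hz, hzL⟩ := exists_conicMap_eq hL
    have hmem := (isBiholomorphism_car.subordinate_iff.mp hcar.2).2.1 hz
    rw [hfL hz, hzL] at hmem
    norm_num [mem_cardioid_iff] at hmem

end CardioidStarlike

theorem theorem3p1 :
    -- (i)
    ((∀ α : ℝ, 0 ≤ α → α ≤ 1 / 4 →
        CardioidStarlike.starCar ⊆ CardioidStarlike.starlikeOfOrder α) ∧
      (∀ α : ℝ, 1 / 4 < α → α < 1 →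
        ¬ CardioidStarlike.starCar ⊆ CardioidStarlike.starlikeOfOrder α)) ∧
    -- (ii)
    ((∀ β : ℝ, 2 / Real.pi * Real.arctan (3 * Real.sqrt (3 / 5)) ≤ β → β ≤ 1 →
        CardioidStarlike.starCar ⊆ CardioidStarlike.stronglyStarlike β) ∧
      (∀ β : ℝ, 0 < β → β < 2 / Real.pi * Real.arctan (3 * Real.sqrt (3 / 5)) →
        ¬ CardioidStarlike.starCar ⊆ CardioidStarlike.stronglyStarlike β)) ∧
    -- (iii)
    ((∀ k : ℝ, 5 / 3 ≤ k → CardioidStarlike.kStarlike k ⊆ CardioidStarlike.starCar) ∧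
      (∀ k : ℝ, 0 ≤ k → k < 5 / 3 →
        ¬ CardioidStarlike.kStarlike k ⊆ CardioidStarlike.starCar)) ∧
    -- (iv)
    ((∀ α : ℝ, (Real.exp 1 - 2) / (2 * (Real.exp 1 - 1)) ≤ α → α < 1 →
        CardioidStarlike.starExp α ⊆ CardioidStarlike.starCar) ∧
      (∀ α : ℝ, 0 ≤ α → α < (Real.exp 1 - 2) / (2 * (Real.exp 1 - 1)) →
        ¬ CardioidStarlike.starExp α ⊆ CardioidStarlike.starCar)) ∧
    -- (v)
    ((∀ α : ℝ, 1 / 2 ≤ α → α < 1 →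
        CardioidStarlike.starLemniscate α ⊆ CardioidStarlike.starCar) ∧
      (∀ α : ℝ, 0 ≤ α → α < 1 / 2 →
        ¬ CardioidStarlike.starLemniscate α ⊆ CardioidStarlike.starCar)) ∧
    -- (vi)
    ((∀ c : ℝ, 0 < c → c ≤ 3 / 4 →
        CardioidStarlike.starCassini c ⊆ CardioidStarlike.starCar) ∧
      (∀ c : ℝ, 3 / 4 < c → c ≤ 1 →
        ¬ CardioidStarlike.starCassini c ⊆ CardioidStarlike.starCar)) ∧
    -- (vii)
    (∀ A B : ℝ, -1 < B → B < A → A ≤ 1 →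
      ((1 - B ^ 2 < 2 * (1 - A * B) ∧ 2 * (1 - A * B) ≤ 3 * (1 - B ^ 2) ∧ 2 * A ≤ 1 + B) ∨
        (3 * (1 - B ^ 2) ≤ 2 * (1 - A * B) ∧ 2 * (1 - A * B) < 5 * (1 - B ^ 2) ∧
          2 * A ≤ 3 + 5 * B)) →
      CardioidStarlike.janowski A B ⊆ CardioidStarlike.starCar) ∧
    -- (viii)
    ((∀ M : ℝ, (3 + Real.sqrt 5) / 4 ≤ M →
        CardioidStarlike.starCar ⊆ CardioidStarlike.janowski 1 (-(M - 1) / M)) ∧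
      (∀ M : ℝ, 1 / 2 < M → M < (3 + Real.sqrt 5) / 4 →
        ¬ CardioidStarlike.starCar ⊆ CardioidStarlike.janowski 1 (-(M - 1) / M))) := by
  open CardioidStarlike in
  have hβ₀ := two_div_pi_mul_arctan_mem_Ioo (by positivity : 0 < 3 * √(3 / 5))
  have hα₀ := exp_one_sub_two_div_mem_Ioo
  refine ⟨⟨fun α _ hα => (starCar_subset_starlikeOfOrder_iff (by linarith)).mpr hα,
      fun α hα hα1 => mt (starCar_subset_starlikeOfOrder_iff hα1).mp hα.not_ge⟩,
    ⟨fun β hβ hβ1 => (starCar_subset_stronglyStarlike_iff (hβ₀.1.trans_le hβ) hβ1).mpr hβ,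
      fun β hβ0 hβ =>
        mt (starCar_subset_stronglyStarlike_iff hβ0 (hβ.trans hβ₀.2).le).mp hβ.not_ge⟩,
    ⟨fun k hk => kStarlike_subset_starCar hk,
      fun k hk0 hk => Set.not_subset.mpr (exists_mem_kStarlike_notMem_starCar hk0 hk)⟩,
    ⟨fun α hα hα1 => (starExp_subset_starCar_iff (hα₀.1.le.trans hα) hα1).mpr hα,
      fun α hα0 hα => mt (starExp_subset_starCar_iff hα0 (hα.trans hα₀.2)).mp hα.not_ge⟩,
    ⟨fun α hα hα1 => (starLemniscate_subset_starCar_iff (by linarith) hα1).mpr hα,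
      fun α hα0 hα => mt (starLemniscate_subset_starCar_iff hα0 (by linarith)).mp hα.not_ge⟩,
    ⟨fun c hc0 hc => (starCassini_subset_starCar_iff hc0 (by linarith)).mpr hc,
      fun c hc hc1 => mt (starCassini_subset_starCar_iff (by linarith) hc1).mp hc.not_ge⟩,
    fun A B hB hAB _ h => ?_,
    ⟨fun M hM => (starCar_subset_janowski_one_iff (by linarith [Real.sqrt_nonneg 5])).mpr hM,
      fun M hM0 hM => mt (starCar_subset_janowski_one_iff hM0).mp hM.not_ge⟩⟩
  rcases h with ⟨-, hcenter, hA⟩ | ⟨hcenter, -, hA⟩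
  · exact janowski_subset_starCar hB hAB hA (by nlinarith)
  · exact janowski_subset_starCar hB hAB (by nlinarith) hA
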